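/- Define the finite Fibonacci words over $\{0,1\}$ by $X_0=\epsilon$ (the empty word), $X_1=1$, $X_2=0$ and $X_n=X_{n-1}X_{n-2}$ for $n>2$. An abelian square is a word $xx'$ with $x$ nonempty such that each letter occurs equally often in $x$ and in $x'$. Let $h(n)$ be the number of distinct words that are factors (contiguous subwords) of $X_n$ and abelian squares (distinct words are counted, not occurrences). Then for all $n\ge 2$, $$h(n)=a_1c_1^n+\cdots+a_{10}c_{10}^n,$$ where $$\begin{aligned} a_1&=(-2+\sqrt5)/20, & c_1&=(3+\sqrt5)/2,\\ a_2&=(-2-\sqrt5)/20, & c_2&=(3-\sqrt5)/2,\\ a_3&=(5-\sqrt5)/20, & c_3&=(1+\sqrt5)/2,\\ a_4&=(5+\sqrt5)/20, & c_4&=(1-\sqrt5)/2,\\ a_5&=1/30, & c_5&=-1,\\ a_6&=-5/6, & c_6&=1,\\ a_7&=1/12-i\sqrt3/12, & c_7&=1/2+i\sqrt3/2,\\ a_8&=1/12+i\sqrt3/12, & c_8&=1/2-i\sqrt3/2,\\ a_9&=1/6+i\sqrt3/12, & c_9&=-1/2+i\sqrt3/2,\\ a_{10}&=1/6-i\sqrt3/12,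 & c_{10}&=-1/2-i\sqrt3/2. \end{aligned}$$ -/

import Mathlib

namespace FibAbelian

/-- The finite Fibonacci words over the alphabet `{0, 1}`:
`X 0` is empty, `X 1 = 1`, `X 2 = 0`, and `X n = X (n - 1) X (n - 2)` for `n > 2`. -/
def X : ℕ → List (Fin 2)
  | 0 => []
  | 1 => [1]
  | 2 => [0]
  | (n + 3) => X (n + 2) ++ X (n + 1)

/-- The Parikh map: the number of occurrences of each letter in a word. -/
def parikh (w : List (Fin 2)) : Fin 2 → ℕ := fun a => w.count a

/-- A (nonempty) abelian square: a word `x x'` with `x` nonempty and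
`x`, `x'` having the same Parikh image. -/
def IsAbelianSquare (w : List (Fin 2)) : Prop :=
  ∃ x x' : List (Fin 2), x ≠ [] ∧ parikh x = parikh x' ∧ w = x ++ x'

/-- The set of all words that are factors (contiguous subwords) of `X n` and abelian squares. -/
def abelianSquareFactors (n : ℕ) : Set (List (Fin 2)) :=
  {w | w <:+: X n ∧ IsAbelianSquare w}

/-- This set is finite, so that its `Set.ncard` is its number of elements. -/
theorem abelianSquareFactors_finite (n : ℕ) : (abelianSquareFactors n).Finite := by
  refine Set.Finite.subset (List.finite_toSet (X n).sublists) ?_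
  intro w hw
  exact List.mem_sublists.2 hw.1.sublist

/-- The number of distinct abelian-square factors of `X n`. -/
noncomputable def h (n : ℕ) : ℕ := (abelianSquareFactors n).ncard

end FibAbelian

namespace FibAbelian

open Nat (fib)

/-! For `n ≥ 2`, `X n` is the prefix of length `fib n` of the infinite Fibonacci word. That word is
balanced enough (`ones_balanced`) that the two halves of an even-length factor differ by at most one
in their number of ones. Hence a nonempty factor is an abelian square exactly when its length and
its number of ones are even (`isAbelianSquare_factor_iff`), that is, when its two end positions have
the same `parity`.

Distinct words are counted by right end. As a prefix grows by one letter to length `e + 1`, with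
`fib (m + 3) - 1 ≤ e + 1 ≤ fib (m + 4) - 2`, the words ending there are new exactly when their left
end is below `fib (m + 2)`: the period `fib (m + 2)` gives the others an earlier copy, and the place
where the next smaller period breaks rules one out for these. So `evenFactors_succ` adds one class
count per letter.

The class counts obey a Fibonacci-type recursion, so each is `fib / 4` plus a term of period six.
Summation gives `sixteen_mul_h`, and Binet's formula with sixth roots of unity gives the stated
form. -/

/-! ### The infinite word and its count of ones. -/

theorem X_add_three (n : ℕ) : X (n + 3) = X (n + 2) ++ X (n + 1) := rfl

theorem length_X : ∀ n, (X n).length = fib n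
  | 0 => rfl
  | 1 => rfl
  | 2 => rfl
  | n + 3 => by
    rw [X_add_three, List.length_append, length_X (n + 2), length_X (n + 1), add_comm,
      ← Nat.fib_add_two]

/-- The letters of the infinite Fibonacci word. -/
def letter (i : ℕ) : Fin 2 := (X (i + 2)).getD i 0

theorem lt_fib_add_two (i : ℕ) : i < fib (i + 2) := by
  induction i with
  | zero => decide
  | succ i ih =>
    have h1 : 0 < fib (i + 1) := Nat.fib_pos.2 (by omega)
    have h2 : fib (i + 1 + 2) = fib (i + 1) + fib (i + 2) := Nat.fib_add_two
    omega

theorem X_prefix_X_add (n k : ℕ) : X (n + 2) <+: X (n + 2 + k) := by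
  induction k with
  | zero => exact List.prefix_refl _
  | succ k ih =>
    refine ih.trans ?_
    have : n + 2 + (k + 1) = n + k + 3 := by omega
    rw [this, X_add_three]
    have : n + 2 + k = n + k + 2 := by omega
    rw [this]
    exact List.prefix_append _ _

theorem X_getElem? {n i : ℕ} (hi : i < fib (n + 2)) : (X (n + 2))[i]? = some (letter i) := by
  have key : ∀ m k, i < fib (m + 2) → (X (m + 2 + k))[i]? = (X (m + 2))[i]? := by
    intro m k h
    rw [(List.prefix_iff_getElem?.1 (X_prefix_X_add m k)) i (by rw [length_X]; exact h)]
    rw [List.getElem?_eq_getElem (by rw [length_X]; exact h)]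
  have h1 : (X (i + 2))[i]? = some (letter i) := by
    rw [letter, List.getD_eq_getElem?_getD,
      List.getElem?_eq_getElem (by rw [length_X]; exact lt_fib_add_two i)]
    rfl
  rcases le_total n i with h | h
  · obtain ⟨k, rfl⟩ := Nat.exists_eq_add_of_le h
    rw [← h1, ← key n k hi]
    congr 2; omega
  · obtain ⟨k, rfl⟩ := Nat.exists_eq_add_of_le h
    rw [← h1, ← key i k (lt_fib_add_two i)]
    congr 2; omega

theorem X_eq_map (n : ℕ) : X (n + 2) = (List.range (fib (n + 2))).map letter := by
  apply List.ext_getElem?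
  intro i
  rcases lt_or_ge i (fib (n + 2)) with h | h
  · rw [X_getElem? h]; simp [h]
  · rw [List.getElem?_eq_none (by rw [length_X]; exact h)]
    simp [h]

theorem letter_fib_add {k j : ℕ} (hj : j < fib (k + 2)) :
    letter (fib (k + 3) + j) = letter j := by
  have h1 : (X (k + 4))[fib (k + 3) + j]? = some (letter (fib (k + 3) + j)) :=
    X_getElem? (n := k + 2) (by
      have := Nat.fib_add_two (n := k + 2)
      show _ < fib (k + 2 + 2)
      have e : fib (k + 2 + 1) = fib (k + 3) := rfl
      omega)
  rw [X_add_three, List.getElem?_append_right (by rw [length_X]; exact Nat.le_add_right _ _), length_X,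
    Nat.add_sub_cancel_left, X_getElem? hj] at h1
  exact (Option.some.inj h1).symm

/-- The number of ones among the first `i` letters of the Fibonacci word. -/
def ones (i : ℕ) : ℕ := Nat.count (fun j => letter j = 1) i

theorem ones_zero : ones 0 = 0 := rfl

theorem ones_succ (i : ℕ) : ones (i + 1) = ones i + if letter i = 1 then 1 else 0 :=
  Nat.count_succ _ _

theorem ones_add_eq {i j l : ℕ} (h : ∀ t < l, letter (i + t) = letter (j + t)) :
    ones (i + l) + ones j = ones (j + l) + ones i := by
  induction l with
  | zero => simp [add_comm]
  | succ l ih =>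
    have := ih fun t ht => h t (by omega)
    rw [← add_assoc, ← add_assoc, ones_succ, ones_succ, h l (by omega)]
    omega

theorem ones_fib_add_of_le {k j : ℕ} (hj : j ≤ fib (k + 2)) :
    ones (fib (k + 3) + j) = ones (fib (k + 3)) + ones j := by
  have := ones_add_eq (i := fib (k + 3)) (j := 0) (l := j) (fun t ht => by
    rw [letter_fib_add (by omega), zero_add])
  simp only [ones_zero, zero_add] at this
  omega

theorem ones_fib (k : ℕ) : ones (fib (k + 2)) = fib k := by
  induction k using Nat.strong_induction_on with
  | _ k ih =>
    match k with
    | 0 => decide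
    | 1 => decide
    | k + 2 =>
      have h : fib (k + 2 + 2) = fib (k + 3) + fib (k + 2) := by
        rw [Nat.fib_add_two, add_comm]
      rw [h, ones_fib_add_of_le le_rfl, ih k (by omega), ih (k + 1) (by omega), Nat.fib_add_two,
        add_comm]

theorem ones_fib_add {k j : ℕ} (hj : j < fib (k + 1)) :
    ones (fib (k + 2) + j) = fib k + ones j := by
  match k, hj with
  | 0, hj =>
    have : j = 0 := by simpa using hj
    subst this; decide
  | k + 1, hj => rw [ones_fib_add_of_le hj.le, ones_fib]

/-! ### Periods of prefixes and where they break. -/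

/-- The prefix of length `fib (k + 4) - 2` has period `fib (k + 2)`. -/
theorem letter_period (k : ℕ) :
    (∀ j, j + 2 < fib (k + 3) → letter (fib (k + 2) + j) = letter j) ∧
    (∀ j, j + 2 = fib (k + 3) → letter (fib (k + 2) + j) ≠ letter j) := by
  induction k with
  | zero =>
    refine ⟨fun j hj => ?_, fun j hj => ?_⟩
    · have : fib (0 + 3) = 2 := rfl
      omega
    · have : fib (0 + 3) = 2 := rfl
      obtain rfl : j = 0 := by omega
      decide
  | succ k ih =>
    have e1 : fib (k + 1 + 3) = fib (k + 3) + fib (k + 2) := by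
      rw [Nat.fib_add_two (n := k + 2), add_comm]
    have e2 : fib (k + 1 + 2) = fib (k + 3) := rfl
    have hpos : 2 ≤ fib (k + 3) := by
      have : fib 3 ≤ fib (k + 3) := Nat.fib_mono (by omega)
      exact this
    -- The two shifts combine into `fib (k + 4)`, which `letter_fib_add` removes; what remains is
    -- the comparison at level `k` with its sides exchanged, so the mismatch is inherited too.
    have big : ∀ j, letter (fib (k + 1 + 2) + (fib (k + 2) + j)) = letter (fib (k + 4) + j) := by
      intro j
      congr 1
      have : fib (k + 4) = fib (k + 1 + 3) := rfl
      omega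
    refine ⟨fun j hj => ?_, fun j hj => ?_⟩
    · rcases lt_or_ge j (fib (k + 2)) with h | h
      · exact letter_fib_add h
      · obtain ⟨j, rfl⟩ := Nat.exists_eq_add_of_le h
        rw [big, letter_fib_add (k := k + 1) (by omega), ih.1 j (by omega)]
    · obtain ⟨j, rfl⟩ : ∃ i, j = fib (k + 2) + i := ⟨j - fib (k + 2), by omega⟩
      rw [big, letter_fib_add (k := k + 1) (by omega)]
      exact (ih.2 j (by omega)).symm

theorem ones_add_fib {k x : ℕ} (hx : x + 2 ≤ fib (k + 3)) :
    ones (x + fib (k + 2)) = ones x + fib k := by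
  have := ones_add_eq (i := fib (k + 2)) (j := 0) (l := x) (fun t ht => by
    rw [(letter_period k).1 t (by omega), zero_add])
  simp only [ones_zero, zero_add, ones_fib] at this
  rw [add_comm x]
  omega

/-- The window of length `fib (k + 2)` starting here is the first to contain the mismatch of
`letter_period`. This unusual number of ones later certifies that a factor is new. -/
theorem ones_add_fib_ne {k x : ℕ} (hx : x + 1 = fib (k + 3)) :
    ones (x + fib (k + 2)) ≠ ones x + fib k := by
  have : 2 ≤ fib (k + 3) := Nat.fib_mono (show 3 ≤ k + 3 by omega)
  obtain ⟨y, rfl⟩ : ∃ y, x = y + 1 := ⟨x - 1, by omega⟩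
  have h1 := ones_add_fib (k := k) (x := y) (by omega)
  have h2 := (letter_period k).2 y (by omega)
  rw [add_right_comm, ones_succ, h1, ones_succ y, add_comm y]
  have : ∀ a b : Fin 2, a ≠ b → (if a = 1 then 1 else 0) ≠ (if b = 1 then 1 else 0) := by decide
  have := this _ _ h2
  omega

/-! ### Factors as pairs of positions. -/

/-- The factor of the Fibonacci word between the positions `i` and `e`. -/
def factor (i e : ℕ) : List (Fin 2) := (List.range' i (e - i)).map letter

theorem length_factor (i e : ℕ) : (factor i e).length = e - i := by simp [factor]

theorem factor_append {i m e : ℕ} (h1 : i ≤ m) (h2 : m ≤ e) :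
    factor i e = factor i m ++ factor m e := by
  obtain ⟨a, rfl⟩ := Nat.exists_eq_add_of_le h1
  obtain ⟨b, rfl⟩ := Nat.exists_eq_add_of_le h2
  simp only [factor, ← List.map_append, Nat.add_sub_cancel_left]
  rw [List.range'_append_1]
  congr 2; omega

theorem factor_eq_iff {i j l : ℕ} :
    factor i (i + l) = factor j (j + l) ↔ ∀ t < l, letter (i + t) = letter (j + t) := by
  simp only [factor, Nat.add_sub_cancel_left]
  constructor
  · intro h t ht
    have := congrArg (fun w => w[t]?) h
    simpa [ht] using this
  · intro h
    apply List.ext_getElem (by simp)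
    intro t h1 h2
    have := h t (by simpa using h1)
    simpa using this

theorem count_one_factor {i e : ℕ} (h : i ≤ e) : (factor i e).count 1 + ones i = ones e := by
  obtain ⟨l, rfl⟩ := Nat.exists_eq_add_of_le h
  clear h
  induction l with
  | zero => simp [factor]
  | succ l ih =>
    rw [factor_append (Nat.le_add_right i l) (by omega), List.count_append, ← add_assoc, ones_succ,
      ← ih]
    have : factor (i + l) (i + l + 1) = [letter (i + l)] := by simp [factor]
    rw [this, List.count_singleton]
    simp only [beq_iff_eq]
    omega

theorem infix_iff_factor {N : ℕ} {w : List (Fin 2)} :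
    w <:+: (List.range N).map letter ↔ ∃ i e, i ≤ e ∧ e ≤ N ∧ w = factor i e := by
  have hN : (List.range N).map letter = factor 0 N := by simp [factor, List.range_eq_range']
  rw [hN]
  constructor
  · rintro ⟨s, t, h⟩
    have hl := congrArg List.length h
    simp only [List.length_append, length_factor] at hl
    refine ⟨s.length, s.length + w.length, by omega, by omega, ?_⟩
    rw [factor_append (m := s.length + w.length) (by omega) (by omega),
      factor_append (m := s.length) (i := 0) (by omega) (by omega)] at h
    have h1 := List.append_inj_left h (by simp [length_factor])
    exact List.append_inj_right h1 (by simp [length_factor])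
  · rintro ⟨i, e, hi, he, rfl⟩
    exact ⟨factor 0 i, factor e N, by
      rw [← factor_append (by omega) hi, ← factor_append (by omega) he]⟩

/-! ### Discrepancy and balance. -/

open Real in
theorem fib_sub_goldenConj_sq_mul_fib (k : ℕ) :
    goldenConj ^ 2 * fib (k + 2) - fib k = goldenConj ^ (k + 2) := by
  have h := fib_succ_sub_goldenRatio_mul_fib (k + 2)
  have h3 : fib (k + 2 + 1) = fib (k + 1) + fib (k + 2) := Nat.fib_add_two
  have h2 : fib (k + 2) = fib k + fib (k + 1) := Nat.fib_add_two
  have := goldenRatio_add_goldenConj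
  rw [← h, h3, goldenConj_sq, h2]
  push_cast
  linear_combination ((fib k : ℝ) + fib (k + 1)) * this

/-- The discrepancy of the ones in the prefixes of the Fibonacci word. -/
noncomputable def disc (i : ℕ) : ℝ := Real.goldenConj ^ 2 * i - ones i

open Real in
theorem disc_fib_add {k j : ℕ} (hj : j < fib (k + 1)) :
    disc (fib (k + 2) + j) = goldenConj ^ (k + 2) + disc j := by
  have h := fib_sub_goldenConj_sq_mul_fib k
  rw [disc, ones_fib_add hj, disc]
  generalize goldenConj = s at h ⊢
  push_cast
  linear_combination h

-- By `disc_fib_add`, `disc i` is a sum of powers of `goldenConj` over a Fibonacci expansion of `i`.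
-- Odd powers are negative and even ones positive, so the extremes are the sums of all odd or all
-- even powers from the available range, which telescope to these bounds.
open Real in
theorem disc_bounds (t : ℕ) :
    (∀ i < fib (2 * t + 2), -goldenConj ^ 2 + goldenConj ^ (2 * t + 2) ≤ disc i ∧
      disc i ≤ -goldenConj + goldenConj ^ (2 * t + 1)) ∧
    (∀ i < fib (2 * t + 3), -goldenConj ^ 2 + goldenConj ^ (2 * t + 2) ≤ disc i ∧
      disc i ≤ -goldenConj + goldenConj ^ (2 * t + 3)) := by
  have hs := goldenConj_sq
  have hneg := goldenConj_neg
  induction t with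
  | zero =>
    have d0 : disc 0 = 0 := by simp [disc, ones_zero]
    have d1 : disc 1 = goldenConj ^ 2 := by
      have : ones 1 = 0 := by decide
      simp [disc, this]
    have h3 : goldenConj ^ 3 = goldenConj ^ 2 + goldenConj := by
      linear_combination goldenConj * hs
    refine ⟨fun i hi => ?_, fun i hi => ?_⟩
    · obtain rfl : i = 0 := by simpa using hi
      rw [d0]; simp
    · have hi' : i < 2 := hi
      interval_cases i
      · rw [d0]
        constructor <;> (norm_num; try linarith [neg_one_lt_goldenConj])
      · rw [d1]
        constructor <;> (norm_num; try linarith [neg_one_lt_goldenConj])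
  | succ t ih =>
    obtain ⟨ih1, ih2⟩ := ih
    have q1 : goldenConj ^ (2 * t + 1) < 0 := Odd.pow_neg ⟨t, rfl⟩ hneg
    have p2 : goldenConj ^ (2 * t + 3) = goldenConj ^ (2 * t + 2) + goldenConj ^ (2 * t + 1) := by
      linear_combination goldenConj ^ (2 * t + 1) * hs
    have p3 : goldenConj ^ (2 * t + 4) = goldenConj ^ (2 * t + 3) + goldenConj ^ (2 * t + 2) := by
      linear_combination goldenConj ^ (2 * t + 2) * hs
    have p4 : goldenConj ^ (2 * t + 5) = goldenConj ^ (2 * t + 4) + goldenConj ^ (2 * t + 3) := by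
      linear_combination goldenConj ^ (2 * t + 3) * hs
    have q3 : goldenConj ^ (2 * t + 3) < 0 := Odd.pow_neg ⟨t + 1, by ring⟩ hneg
    have q4 : 0 < goldenConj ^ (2 * t + 4) := Even.pow_pos ⟨t + 2, by ring⟩ hneg.ne
    have f4 : fib (2 * t + 4) = fib (2 * t + 3) + fib (2 * t + 2) := by
      rw [Nat.fib_add_two, add_comm]
    have f5 : fib (2 * t + 5) = fib (2 * t + 4) + fib (2 * t + 3) := by
      rw [Nat.fib_add_two, add_comm]
    have key : ∀ i < fib (2 * t + 4), -goldenConj ^ 2 + goldenConj ^ (2 * t + 4) ≤ disc i ∧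
        disc i ≤ -goldenConj + goldenConj ^ (2 * t + 3) := by
      intro i hi
      rcases lt_or_ge i (fib (2 * t + 3)) with h | h
      · have := ih2 i h
        constructor <;> linarith
      · obtain ⟨j, rfl⟩ := Nat.exists_eq_add_of_le h
        have hj : j < fib (2 * t + 1 + 1) := by
          have : fib (2 * t + 1 + 1) = fib (2 * t + 2) := rfl
          omega
        have h1 := disc_fib_add hj
        have h2 := ih1 j hj
        have h3 : disc (fib (2 * t + 3) + j) = goldenConj ^ (2 * t + 3) + disc j := h1
        rw [h3]
        constructor <;> linarith
    refine ⟨key, fun i hi => ?_⟩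
    have e : 2 * (t + 1) + 3 = 2 * t + 5 := by ring
    have e' : 2 * (t + 1) + 2 = 2 * t + 4 := by ring
    rw [e] at hi ⊢
    rw [e']
    rcases lt_or_ge i (fib (2 * t + 4)) with h | h
    · have := key i h
      constructor <;> linarith
    · obtain ⟨j, rfl⟩ := Nat.exists_eq_add_of_le h
      have hj : j < fib (2 * t + 2 + 1) := by
        have : fib (2 * t + 2 + 1) = fib (2 * t + 3) := rfl
        omega
      have h1 := disc_fib_add hj
      have h2 := ih2 j hj
      have h3 : disc (fib (2 * t + 4) + j) = goldenConj ^ (2 * t + 4) + disc j := h1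
      rw [h3]
      constructor <;> linarith

open Real in
theorem disc_mem_Ioo (i : ℕ) : disc i ∈ Set.Ioo (-goldenConj ^ 2) (-goldenConj) := by
  have hi : i < fib (2 * i + 2) :=
    (lt_fib_add_two i).trans_le (Nat.fib_mono (by omega))
  have := (disc_bounds i).1 i hi
  have q1 : goldenConj ^ (2 * i + 1) < 0 := Odd.pow_neg ⟨i, rfl⟩ goldenConj_neg
  have q4 : 0 < goldenConj ^ (2 * i + 2) := Even.pow_pos ⟨i + 1, by ring⟩ goldenConj_neg.ne
  constructor <;> linarith

/-- The Fibonacci word is balanced on adjacent blocks. -/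
theorem ones_balanced (i m : ℕ) :
    ones (i + 2 * m) + ones i ≤ 2 * ones (i + m) + 1 ∧
      2 * ones (i + m) ≤ ones (i + 2 * m) + ones i + 1 := by
  have h1 := disc_mem_Ioo i
  have h2 := disc_mem_Ioo (i + m)
  have h3 := disc_mem_Ioo (i + 2 * m)
  have hs := Real.goldenConj_sq
  simp only [disc, Set.mem_Ioo, hs] at h1 h2 h3
  push_cast at h1 h2 h3
  -- The interval containing `disc` has length `goldenConj ^ 2 - goldenConj = 1`, so a second
  -- difference of `disc` lies strictly between -2 and 2, and its linear part cancels.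
  have a1 : ((ones (i + 2 * m) + ones i : ℕ) : ℝ) < ((2 * ones (i + m) + 2 : ℕ) : ℝ) := by
    push_cast; linarith
  have a2 : ((2 * ones (i + m) : ℕ) : ℝ) < ((ones (i + 2 * m) + ones i + 2 : ℕ) : ℝ) := by
    push_cast; linarith
  have b1 := Nat.cast_lt.1 a1
  have b2 := Nat.cast_lt.1 a2
  omega

/-! ### Abelian squares as a parity condition. -/

theorem length_eq_count_add_count (w : List (Fin 2)) : w.length = w.count 0 + w.count 1 := by
  induction w with
  | nil => rfl
  | cons a w ih =>
    have : ∀ a : Fin 2, a = 0 ∨ a = 1 := by decide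
    rcases this a with rfl | rfl <;> simp [ih] <;> omega

theorem parikh_eq_iff {x y : List (Fin 2)} :
    parikh x = parikh y ↔ x.length = y.length ∧ x.count 1 = y.count 1 := by
  have hx := length_eq_count_add_count x
  have hy := length_eq_count_add_count y
  constructor
  · intro h
    have h0 : x.count 0 = y.count 0 := congrFun h 0
    have h1 : x.count 1 = y.count 1 := congrFun h 1
    exact ⟨by omega, h1⟩
  · rintro ⟨hl, h1⟩
    funext a
    have : ∀ a : Fin 2, a = 0 ∨ a = 1 := by decide
    rcases this a with rfl | rfl
    · show x.count 0 = y.count 0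
      omega
    · exact h1

/-- A nonempty word each of whose letters occurs an even number of times. -/
def IsEven (w : List (Fin 2)) : Prop := w ≠ [] ∧ Even w.length ∧ Even (w.count 1)

theorem isAbelianSquare_factor_iff {i e : ℕ} (hie : i ≤ e) :
    IsAbelianSquare (factor i e) ↔ IsEven (factor i e) := by
  constructor
  · rintro ⟨x, y, hx, hxy, h⟩
    obtain ⟨hl, h1⟩ := parikh_eq_iff.1 hxy
    rw [h]
    refine ⟨by simp [hx], ?_, ?_⟩
    · rw [List.length_append, ← hl]; exact ⟨_, rfl⟩
    · rw [List.count_append, ← h1]; exact ⟨_, rfl⟩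
  · rintro ⟨h0, ⟨m, hm⟩, ⟨c, hc⟩⟩
    have hlen := hm
    rw [length_factor] at hlen
    obtain rfl : e = i + 2 * m := by omega
    have hm0 : m ≠ 0 := by
      rintro rfl
      exact h0 (List.length_eq_zero_iff.1 hm)
    have c0 := count_one_factor hie
    have c1 := count_one_factor (show i ≤ i + m by omega)
    have c2 := count_one_factor (show i + m ≤ i + 2 * m by omega)
    -- The halves differ by at most one in their number of ones, and the even total makes this
    -- difference even, hence zero.
    have hb := ones_balanced i m
    refine ⟨factor i (i + m), factor (i + m) (i + 2 * m), ?_, ?_,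
      factor_append (by omega) (by omega)⟩
    · intro h
      have := congrArg List.length h
      rw [length_factor] at this
      simp at this
      exact hm0 this
    · rw [parikh_eq_iff, length_factor, length_factor]
      omega

/-- The even factors of the prefix of length `N` of the Fibonacci word. -/
def evenFactors (N : ℕ) : Set (List (Fin 2)) :=
  {w | ∃ i e, i ≤ e ∧ e ≤ N ∧ w = factor i e ∧ IsEven w}

theorem abelianSquareFactors_eq (n : ℕ) :
    abelianSquareFactors (n + 2) = evenFactors (fib (n + 2)) := by
  ext w
  simp only [abelianSquareFactors, evenFactors, Set.mem_ofPred_eq, X_eq_map, infix_iff_factor]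
  constructor
  · rintro ⟨⟨i, e, hi, he, rfl⟩, h⟩
    exact ⟨i, e, hi, he, rfl, (isAbelianSquare_factor_iff hi).1 h⟩
  · rintro ⟨i, e, hi, he, rfl, h⟩
    exact ⟨⟨i, e, hi, he, rfl⟩, (isAbelianSquare_factor_iff hi).2 h⟩

theorem evenFactors_finite (N : ℕ) : (evenFactors N).Finite := by
  refine Set.Finite.subset (List.finite_toSet ((List.range N).map letter).sublists) ?_
  rintro w ⟨i, e, hi, he, hw, -⟩
  exact List.mem_sublists.2 (infix_iff_factor.2 ⟨i, e, hi, he, hw⟩).sublist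

/-! ### Which factors are new at a given right end. -/

/-- A factor whose left end is small compared to its right end has no earlier occurrence. -/
theorem factor_ne_of_lt {m i j l : ℕ} (hi : i < fib (m + 2)) (hl : fib (m + 3) ≤ i + l + 1)
    (hj : j < i) : factor i (i + l) ≠ factor j (j + l) := by
  intro h
  rw [factor_eq_iff] at h
  match m, hi, hl with
  | 0, hi, hl =>
    have : fib (0 + 2) = 1 := rfl
    omega
  | k + 1, hi, hl =>
    have e2 : fib (k + 1 + 2) = fib (k + 3) := rfl
    have e3 : fib (k + 1 + 3) = fib (k + 2) + fib (k + 3) := Nat.fib_add_two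
    -- The offset places a window of length `fib (k + 2)` at position `fib (k + 3) - 1`, where its
    -- number of ones differs from `fib k`; the copy starting at `j + a` lies earlier and has
    -- exactly `fib k`.
    obtain ⟨a, ha⟩ : ∃ a, i + a + 1 = fib (k + 3) := ⟨fib (k + 3) - 1 - i, by omega⟩
    have heq : ∀ t < fib (k + 2), letter (i + a + t) = letter (j + a + t) := by
      intro t ht
      rw [add_assoc, add_assoc]
      exact h _ (by omega)
    have h1 := ones_add_eq heq
    have h2 := ones_add_fib (k := k) (x := j + a) (by omega)
    have h3 := ones_add_fib_ne (k := k) (x := i + a) (by omega)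
    omega

/-- A factor whose left end is large compared to its right end has an earlier occurrence. -/
theorem factor_eq_of_le {m i l : ℕ} (hl : fib (m + 2) + i + l + 2 ≤ fib (m + 4)) :
    factor (fib (m + 2) + i) (fib (m + 2) + i + l) = factor i (i + l) := by
  rw [factor_eq_iff]
  intro t ht
  rw [add_assoc]
  refine (letter_period m).1 _ ?_
  have : fib (m + 4) = fib (m + 2) + fib (m + 3) := Nat.fib_add_two
  omega

/-- The Parikh image modulo two of the prefix of length `i`. -/
def parity (i : ℕ) : ZMod 2 × ZMod 2 := ((i : ZMod 2), (ones i : ZMod 2))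

theorem natCast_eq_iff_even {a b c : ℕ} (h : a + b = c) : (b : ZMod 2) = c ↔ Even a := by
  subst h
  rw [← ZMod.natCast_eq_zero_iff_even]
  push_cast
  simp

theorem isEven_factor_iff {i e : ℕ} (h : i ≤ e) :
    IsEven (factor i e) ↔ i < e ∧ parity i = parity e := by
  have hc := count_one_factor h
  have hl : (factor i e).length + i = e := by rw [length_factor]; omega
  rw [IsEven, parity, parity, Prod.mk.injEq, natCast_eq_iff_even hc, natCast_eq_iff_even hl,
    ← List.length_pos_iff_ne_nil, length_factor, Nat.sub_pos_iff_lt]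

/-- The number of proper prefixes of the Fibonacci word of length `fib m` in a parity class. -/
def classCount (m : ℕ) (c : ZMod 2 × ZMod 2) : ℕ :=
  ((Finset.range (fib m)).filter fun i => parity i = c).card

theorem evenFactors_succ {m e : ℕ} (h1 : fib (m + 3) ≤ e + 2) (h2 : e + 3 ≤ fib (m + 4)) :
    (evenFactors (e + 1)).ncard = (evenFactors e).ncard + classCount (m + 2) (parity (e + 1)) := by
  have hF : fib (m + 3) = fib (m + 1) + fib (m + 2) := Nat.fib_add_two
  have hF4 : fib (m + 4) = fib (m + 2) + fib (m + 3) := Nat.fib_add_two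
  have hpos : 0 < fib (m + 1) := Nat.fib_pos.2 (by omega)
  set T : Finset ℕ := (Finset.range (fib (m + 2))).filter fun i => parity i = parity (e + 1)
    with hT
  have hTle : ∀ i ∈ T, i ≤ e := by
    intro i hi
    have := Finset.mem_range.1 (Finset.mem_filter.1 hi).1
    omega
  have hinj : Set.InjOn (fun i => factor i (e + 1)) (T : Set ℕ) := by
    intro i hi j hj hij
    have := congrArg List.length hij
    simp only [length_factor] at this
    have := hTle i hi
    have := hTle j hj
    omega
  have hunion : evenFactors (e + 1) = evenFactors e ∪ (fun i => factor i (e + 1)) '' (T : Set ℕ) := by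
    ext w
    constructor
    · rintro ⟨i, e', hi, he, rfl, hw⟩
      obtain ⟨hlt, hpar⟩ := (isEven_factor_iff hi).1 hw
      rcases Nat.lt_or_ge e' (e + 1) with h | h
      · exact Or.inl ⟨i, e', hi, by omega, rfl, hw⟩
      · obtain rfl : e' = e + 1 := by omega
        rcases Nat.lt_or_ge i (fib (m + 2)) with h' | h'
        · exact Or.inr ⟨i, by simp [hT, h', hpar], rfl⟩
        -- Shifting left by `fib (m + 2)` gives an occurrence that already ends by `e`.
        · obtain ⟨j, rfl⟩ := Nat.exists_eq_add_of_le h'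
          obtain ⟨l, hl⟩ := Nat.exists_eq_add_of_le hi
          have := factor_eq_of_le (m := m) (i := j) (l := l) (by omega)
          rw [hl, this] at hw ⊢
          have : 0 < fib (m + 2) := Nat.fib_pos.2 (by omega)
          exact Or.inl ⟨j, j + l, by omega, by omega, rfl, hw⟩
    · rintro (⟨i, e', hi, he, rfl, hw⟩ | ⟨i, hi, rfl⟩)
      · exact ⟨i, e', hi, by omega, rfl, hw⟩
      · have hle := hTle i hi
        exact ⟨i, e + 1, by omega, le_rfl, rfl,
          (isEven_factor_iff (by omega)).2 ⟨by omega, (Finset.mem_filter.1 hi).2⟩⟩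
  have hdisj : Disjoint (evenFactors e) ((fun i => factor i (e + 1)) '' (T : Set ℕ)) := by
    rw [Set.disjoint_left]
    rintro w ⟨j, e', hj, he, hw, -⟩ ⟨i, hi, hw'⟩
    have hle := hTle i hi
    have hlt := Finset.mem_range.1 (Finset.mem_filter.1 hi).1
    have heq : factor i (e + 1) = factor j e' := hw'.trans hw
    have hlen := congrArg List.length heq
    simp only [length_factor] at hlen
    obtain ⟨l, hl⟩ := Nat.exists_eq_add_of_le hj
    obtain rfl := hl
    have : e + 1 = i + l := by omega
    rw [this] at heq
    exact factor_ne_of_lt hlt (by omega) (by omega) heq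
  rw [hunion, Set.ncard_union_eq hdisj (evenFactors_finite e) (T.finite_toSet.image _),
    hinj.ncard_image, Set.ncard_coe_finset]
  rfl

/-! ### Sizes of the parity classes. -/

theorem parity_fib_add {k j : ℕ} (hj : j < fib (k + 1)) :
    parity (fib (k + 2) + j) = parity (fib (k + 2)) + parity j := by
  simp only [parity, ones_fib_add hj, ones_fib, Prod.mk_add_mk]
  push_cast
  rfl

/-- The parity class of `fib m`, as a function of `m` modulo six. -/
def parityFib (r : ZMod 6) : ZMod 2 × ZMod 2 :=
  (![(0, 1), (1, 1), (1, 0), (0, 1), (1, 1), (1, 0)] : Fin 6 → ZMod 2 × ZMod 2) r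

/-- The parity class of `fib m - 1`, as a function of `m` modulo six. -/
def parityPred (r : ZMod 6) : ZMod 2 × ZMod 2 :=
  (![(1, 1), (0, 0), (0, 0), (1, 0), (0, 1), (0, 1)] : Fin 6 → ZMod 2 × ZMod 2) r

/-- The periodic part of `4 * classCount m c`. -/
def countDefect (r : ZMod 6) (c : ZMod 2 × ZMod 2) : ℤ :=
  (![![![0, 0], ![0, 0]], ![![3, -1], ![-1, -1]], ![![3, -1], ![-1, -1]],
    ![![2, -2], ![2, -2]], ![![1, 1], ![1, -3]], ![![-1, 3], ![-1, -1]]] :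
    Fin 6 → Fin 2 → Fin 2 → ℤ) r c.1 c.2

theorem parity_fib_add_four (m : ℕ) :
    parity (fib (m + 4)) = parity (fib (m + 3)) + parity (fib (m + 2)) := by
  have h4 : fib (m + 4) = fib (m + 3) + fib (m + 2) := by rw [Nat.fib_add_two, add_comm]
  have h2 : fib (m + 2) = fib (m + 1) + fib m := by rw [Nat.fib_add_two, add_comm]
  have o4 : ones (fib (m + 4)) = ones (fib (m + 3)) + ones (fib (m + 2)) := by
    rw [ones_fib (m + 2), ones_fib (m + 1), ones_fib m, h2]
  rw [parity, o4, h4]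
  simp [parity]

theorem parity_fib (m : ℕ) : parity (fib (m + 2)) = parityFib (m + 2) := by
  have step : ∀ r : ZMod 6, parityFib (r + 2 + 2) = parityFib (r + 1 + 2) + parityFib (r + 2) := by
    decide
  induction m using Nat.strong_induction_on with
  | _ m ih =>
    match m with
    | 0 => decide
    | 1 => decide
    | m + 2 =>
      have h1 := ih m (by omega)
      have h2 := ih (m + 1) (by omega)
      rw [parity_fib_add_four, h1]
      simp only [Nat.cast_add, Nat.cast_ofNat, Nat.cast_one] at h2 ⊢
      rw [step, ← h2]

theorem parity_fib_pred (m : ℕ) : parity (fib (m + 2) - 1) = parityPred (m + 2) := by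
  have step : ∀ r : ZMod 6, parityPred (r + 2 + 2) = parityFib (r + 1 + 2) + parityPred (r + 2) := by
    decide
  induction m using Nat.strong_induction_on with
  | _ m ih =>
    match m with
    | 0 => decide
    | 1 => decide
    | m + 2 =>
      have h1 := ih m (by omega)
      have h2 := parity_fib (m + 1)
      have hpos : 0 < fib (m + 2) := Nat.fib_pos.2 (by omega)
      have h4 : fib (m + 2 + 2) - 1 = fib (m + 1 + 2) + (fib (m + 2) - 1) := by
        have : fib (m + 2 + 2) = fib (m + 2) + fib (m + 1 + 2) := Nat.fib_add_two
        omega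
      rw [h4, parity_fib_add (by have : fib (m + 1 + 1) = fib (m + 2) := rfl; omega), h1]
      simp only [Nat.cast_add, Nat.cast_ofNat, Nat.cast_one] at h2 ⊢
      rw [step, ← h2]

/-- Sums over a block of prefixes of the Fibonacci word, by parity class. -/
theorem sum_parity_block (m : ℕ) (g : ZMod 2 × ZMod 2 → ℤ) :
    ∑ e ∈ Finset.Ico (fib (m + 3)) (fib (m + 4)), g (parity e) =
      ∑ c, (classCount (m + 2) c : ℤ) * g (c + parity (fib (m + 3))) := by
  have h4 : fib (m + 4) = fib (m + 2) + fib (m + 3) := Nat.fib_add_two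
  rw [Finset.sum_Ico_eq_sum_range, h4, Nat.add_sub_cancel]
  have h : ∀ j ∈ Finset.range (fib (m + 2)), g (parity (fib (m + 3) + j)) =
      g (parity j + parity (fib (m + 3))) := by
    intro j hj
    rw [parity_fib_add (k := m + 1) (Finset.mem_range.1 hj), add_comm]
  rw [Finset.sum_congr rfl h,
    Finset.sum_comp (s := Finset.range (fib (m + 2))) (fun c => g (c + parity (fib (m + 3)))) parity]
  rw [← Finset.sum_subset (Finset.subset_univ ((Finset.range (fib (m + 2))).image parity))]
  · exact Finset.sum_congr rfl fun c _ => by simp [classCount]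
  · intro c _ hc
    have : classCount (m + 2) c = 0 := by
      rw [classCount, Finset.card_eq_zero, Finset.filter_eq_empty_iff]
      intro i hi hic
      exact hc (Finset.mem_image.2 ⟨i, hi, hic⟩)
    simp [this]

/-- Past `fib (m + 2)`, the positions repeat the initial ones with parity translated by a constant;
translation is its own inverse in characteristic two. -/
theorem classCount_add_two (m : ℕ) (c : ZMod 2 × ZMod 2) :
    classCount (m + 3) c = classCount (m + 2) c + classCount (m + 1) (c + parity (fib (m + 2))) := by
  have h3 : fib (m + 3) = fib (m + 2) + fib (m + 1) := by rw [Nat.fib_add_two, add_comm]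
  simp only [classCount, Finset.card_filter]
  rw [h3, Finset.sum_range_add]
  congr 1
  refine Finset.sum_congr rfl fun j hj => ?_
  rw [parity_fib_add (Finset.mem_range.1 hj)]
  have : (parity (fib (m + 2)) + parity j = c) ↔ (parity j = c + parity (fib (m + 2))) := by
    generalize parity (fib (m + 2)) = v
    generalize parity j = w
    revert v w c
    decide
  simp only [this]

theorem four_mul_classCount (m : ℕ) (c : ZMod 2 × ZMod 2) :
    4 * (classCount (m + 1) c : ℤ) = fib (m + 1) + countDefect (m + 1) c := by
  -- The `fib` terms satisfy the recursion by themselves, so only the periodic parts remain, a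
  -- finite check over residues.
  have step : ∀ (r : ZMod 6) (c : ZMod 2 × ZMod 2), countDefect (r + 2 + 1) c =
      countDefect (r + 1 + 1) c + countDefect (r + 1) (c + parityFib (r + 2)) := by decide
  induction m using Nat.strong_induction_on generalizing c with
  | _ m ih =>
    match m with
    | 0 => revert c; decide
    | 1 => revert c; decide
    | m + 2 =>
      have h1 := ih m (by omega) (c + parity (fib (m + 2)))
      have h2 := ih (m + 1) (by omega) c
      have h3 : fib (m + 2 + 1) = fib (m + 1) + fib (m + 1 + 1) := Nat.fib_add_two
      rw [classCount_add_two, h3]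
      rw [parity_fib] at h1 ⊢
      have h := step m c
      simp only [Nat.cast_add, Nat.cast_ofNat, Nat.cast_one] at h1 h2 h ⊢
      linarith

/-! ### Summation over blocks of right ends. -/

theorem ncard_evenFactors_block (m k : ℕ) (hk : k + fib (m + 3) ≤ fib (m + 4)) :
    ((evenFactors (fib (m + 3) - 2 + k)).ncard : ℤ) = (evenFactors (fib (m + 3) - 2)).ncard +
      ∑ e ∈ Finset.Ico (fib (m + 3) - 1) (fib (m + 3) - 1 + k),
        (classCount (m + 2) (parity e) : ℤ) := by
  have h2 : 2 ≤ fib (m + 3) := Nat.fib_mono (show 3 ≤ m + 3 by omega)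
  induction k with
  | zero => simp
  | succ k ih =>
    have e : fib (m + 3) - 2 + k + 1 = fib (m + 3) - 1 + k := by omega
    rw [← add_assoc, evenFactors_succ (m := m) (by omega) (by omega), ← add_assoc,
      Finset.sum_Ico_succ_top (by omega), e, ← add_assoc, ← ih (by omega)]
    push_cast
    rfl

/-- The periodic part of `16 * (evenFactors (fib m - 2)).ncard`. -/
def factorDefect (r : ZMod 6) : ℤ := (![-12, -16, -16, -4, -8, -24] : Fin 6 → ℤ) r

/-- The periodic part of `16 * h m`. -/
def squareDefect (r : ZMod 6) : ℤ := (![-4, -16, -8, -12, -24, -16] : Fin 6 → ℤ) r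

/-- The defects sum to zero over the four classes, so the cross terms vanish when the product is
expanded. -/
theorem sixteen_mul_sum_classCount (m : ℕ) (v : ZMod 2 × ZMod 2) :
    16 * ∑ c, (classCount (m + 2) c : ℤ) * classCount (m + 2) (c + v) =
      4 * (fib (m + 2) : ℤ) ^ 2 +
        ∑ c, countDefect (m + 2) c * countDefect (m + 2) (c + v) := by
  have hsum : ∀ (r : ZMod 6) (v : ZMod 2 × ZMod 2), ∑ c, countDefect r (c + v) = 0 := by decide
  have hA : ∀ c, 4 * (classCount (m + 2) c : ℤ) = fib (m + 2) + countDefect (m + 2) c := by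
    intro c
    have := four_mul_classCount (m + 1) c
    push_cast at this
    rw [add_assoc (m : ZMod 6), one_add_one_eq_two] at this
    exact this
  have h0 := hsum (m + 2) 0
  have hv := hsum (m + 2) v
  simp only [add_zero] at h0
  have hterm : ∀ c, 16 * ((classCount (m + 2) c : ℤ) * classCount (m + 2) (c + v)) =
      (fib (m + 2) : ℤ) ^ 2 + fib (m + 2) * countDefect (m + 2) (c + v) +
        fib (m + 2) * countDefect (m + 2) c +
        countDefect (m + 2) c * countDefect (m + 2) (c + v) := by
    intro c
    linear_combination 4 * (classCount (m + 2) (c + v) : ℤ) * hA c +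
      (fib (m + 2) + countDefect (m + 2) c) * hA (c + v)
  have hcard : Fintype.card (ZMod 2 × ZMod 2) = 4 := by decide
  rw [Finset.mul_sum, Finset.sum_congr rfl fun c _ => hterm c]
  simp only [Finset.sum_add_distrib, ← Finset.mul_sum, h0, hv, Finset.sum_const, Finset.card_univ,
    hcard]
  simp

theorem sixteen_mul_ncard_evenFactors (m : ℕ) :
    16 * ((evenFactors (fib (m + 3) - 2)).ncard : ℤ) =
      4 * fib (m + 1) * fib (m + 2) + factorDefect (m + 3) := by
  have step : ∀ r : ZMod 6,
      ∑ c, countDefect (r + 2) c * countDefect (r + 2) (c + parityFib (r + 1 + 2)) +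
        4 * countDefect (r + 2) (parityPred (r + 1 + 2)) -
        4 * countDefect (r + 2) (parityPred (r + 2 + 2)) =
      factorDefect (r + 1 + 3) - factorDefect (r + 3) := by decide
  induction m with
  | zero =>
    have : evenFactors (fib (0 + 3) - 2) = ∅ := by
      ext w
      simp only [Set.mem_empty_iff_false, iff_false]
      rintro ⟨i, e, hi, he, rfl, hw⟩
      have := ((isEven_factor_iff hi).1 hw).1
      have : fib (0 + 3) - 2 = 0 := rfl
      omega
    rw [this]
    simp only [Set.ncard_empty]
    decide
  | succ m ih =>
    have h2 : 2 ≤ fib (m + 3) := Nat.fib_mono (show 3 ≤ m + 3 by omega)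
    have h4 : fib (m + 4) = fib (m + 2) + fib (m + 3) := Nat.fib_add_two
    have h3 : fib (m + 3) = fib (m + 1) + fib (m + 2) := Nat.fib_add_two
    have hb := ncard_evenFactors_block m (fib (m + 2)) (by omega)
    have e1 : fib (m + 3) - 2 + fib (m + 2) = fib (m + 4) - 2 := by omega
    have e2 : fib (m + 3) - 1 + fib (m + 2) = fib (m + 4) - 1 := by omega
    rw [e1, e2] at hb
    set g : ℕ → ℤ := fun e => (classCount (m + 2) (parity e) : ℤ) with hg
    -- The counting block starts one position before the block of `sum_parity_block`; the two
    -- boundary terms are the reason for `parityPred`.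
    have s1 : ∑ e ∈ Finset.Ico (fib (m + 3) - 1) (fib (m + 4) - 1), g e + g (fib (m + 4) - 1) =
        g (fib (m + 3) - 1) + ∑ e ∈ Finset.Ico (fib (m + 3)) (fib (m + 4)), g e := by
      rw [← Finset.sum_Ico_succ_top (by omega), Finset.sum_eq_sum_Ico_succ_bot (by omega)]
      congr 3 <;> omega
    have s2 : ∑ e ∈ Finset.Ico (fib (m + 3)) (fib (m + 4)), g e = _ :=
      sum_parity_block m fun c => (classCount (m + 2) c : ℤ)
    have s3 := sixteen_mul_sum_classCount m (parity (fib (m + 3)))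
    have g1 := four_mul_classCount (m + 1) (parity (fib (m + 3) - 1))
    have g2 := four_mul_classCount (m + 1) (parity (fib (m + 4) - 1))
    have c0 : ((m + 1 : ℕ) : ZMod 6) + 1 = m + 2 := by push_cast; ring
    rw [c0] at g1 g2
    have p1 := parity_fib (m + 1)
    have p2 := parity_fib_pred (m + 1)
    have p3 := parity_fib_pred (m + 2)
    have st := step m
    push_cast at p1 p2 p3
    rw [← p1, ← p2, ← p3] at st
    have e5 : fib (m + 1 + 1) = fib (m + 2) := rfl
    have e6 : fib (m + 1 + 2) = fib (m + 3) := rfl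
    have e7 : fib (m + 2 + 2) = fib (m + 4) := rfl
    have e8 : fib (m + 1 + 3) = fib (m + 4) := rfl
    have h3' : (fib (m + 3) : ℤ) = fib (m + 1) + fib (m + 2) := by exact_mod_cast h3
    have g1' : 4 * g (fib (m + 3) - 1) = _ := g1
    have g2' : 4 * g (fib (m + 4) - 1) = _ := g2
    rw [e6, e7] at st
    rw [e5, e6, e8, hb, Nat.cast_add, Nat.cast_one, h3']
    rw [s2] at s1
    linear_combination ih + 16 * s1 + s3 + st + 4 * g1' - 4 * g2'

theorem h_add_two (n : ℕ) : h (n + 2) = (evenFactors (fib (n + 2))).ncard := by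
  rw [h, abelianSquareFactors_eq]

theorem sixteen_mul_h (n : ℕ) :
    16 * (h (n + 2) : ℤ) = 4 * fib n * fib (n + 1) + 8 * fib (n + 1) + squareDefect (n + 2) := by
  have z0 : (evenFactors 0).ncard = 0 := by
    have := sixteen_mul_ncard_evenFactors 0
    have h1 : fib (0 + 3) - 2 = 0 := rfl
    rw [h1] at this
    have h2 : 4 * (fib (0 + 1) : ℤ) * fib (0 + 2) + factorDefect ((0 : ℕ) + 3) = 0 := by decide
    rw [h2] at this
    omega
  have z1 : (evenFactors 1).ncard = 0 := by
    rw [evenFactors_succ (m := 0) (by decide) (by decide), z0]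
    decide
  match n with
  | 0 =>
    have h1 : fib (0 + 2) = 1 := rfl
    rw [h_add_two, h1, z1]
    decide
  | 1 =>
    have h1 : fib (1 + 2) = 1 + 1 := rfl
    rw [h_add_two, h1, evenFactors_succ (m := 1) (by decide) (by decide), z1]
    decide
  | m + 2 =>
    have step : ∀ r : ZMod 6,
        4 * countDefect (r + 3) (parityPred (r + 2 + 2)) +
          4 * countDefect (r + 3) (parityFib (r + 2 + 2)) + factorDefect (r + 1 + 3) =
        squareDefect (r + 2 + 2) := by decide
    have h3 : 2 ≤ fib (m + 3) := Nat.fib_mono (show 3 ≤ m + 3 by omega)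
    have h4 : fib (m + 4) = fib (m + 2) + fib (m + 3) := Nat.fib_add_two
    have h5 : fib (m + 5) = fib (m + 3) + fib (m + 4) := Nat.fib_add_two
    have hpos : 0 < fib (m + 2) := Nat.fib_pos.2 (by omega)
    -- The block formula stops at `fib (m + 4) - 2`. The last two right ends belong to the next
    -- block and contribute the term `8 * fib (n + 1)`.
    obtain ⟨a, ha⟩ : ∃ a, fib (m + 4) = a + 2 := ⟨fib (m + 4) - 2, by omega⟩
    have hG := sixteen_mul_ncard_evenFactors (m + 1)
    have s1 := evenFactors_succ (m := m + 1) (e := a) (by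
      show fib (m + 4) ≤ _
      omega) (by
      show _ ≤ fib (m + 5)
      omega)
    have s2 := evenFactors_succ (m := m + 1) (e := a + 1) (by
      show fib (m + 4) ≤ _
      omega) (by
      show _ ≤ fib (m + 5)
      omega)
    have p1 := parity_fib (m + 2)
    have p2 := parity_fib_pred (m + 2)
    have e7 : fib (m + 2 + 2) = a + 1 + 1 := ha
    have e8 : fib (m + 1 + 3) = a + 1 + 1 := ha
    rw [e7] at p1 p2
    rw [e8] at hG
    have e9 : a + 1 + 1 - 1 = a + 1 := rfl
    have e10 : a + 1 + 1 - 2 = a := rfl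
    rw [e9] at p2
    rw [e10] at hG
    have g1 := four_mul_classCount (m + 2) (parity (a + 1))
    have g2 := four_mul_classCount (m + 2) (parity (a + 1 + 1))
    have c0 : ((m + 2 : ℕ) : ZMod 6) + 1 = m + 3 := by push_cast; ring
    rw [c0] at g1 g2
    have st := step m
    push_cast at p1 p2
    rw [← p1, ← p2] at st
    rw [h_add_two, e7, s2, s1]
    push_cast at hG ⊢
    have e11 : fib (m + 1 + 2) = fib (m + 2 + 1) := rfl
    have e12 : fib (m + 1 + 1) = fib (m + 2) := rfl
    have e13 : classCount (m + 1 + 2) = classCount (m + 2 + 1) := rfl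
    rw [e11, e12] at hG
    rw [e13]
    linear_combination hG + 4 * g1 + 4 * g2 + st

/-! ### Closed form by Binet and roots of unity. -/

theorem pow_succ_eq_fib {R : Type*} [CommRing R] {p : R} (hp : p ^ 2 = p + 1) (k : ℕ) :
    p ^ (k + 1) = fib (k + 1) * p + fib k := by
  induction k with
  | zero => simp
  | succ k ih =>
    rw [pow_succ, ih, Nat.fib_add_two (n := k)]
    push_cast
    linear_combination (fib (k + 1) : R) * hp

theorem fib_cassini (n : ℕ) :
    (fib (n + 1) : ℂ) ^ 2 - fib n * fib (n + 1) - fib n ^ 2 = (-1) ^ n := by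
  induction n with
  | zero => simp
  | succ n ih =>
    rw [Nat.fib_add_two (n := n), pow_succ (-1 : ℂ), ← ih]
    push_cast
    ring

/-- The bases are the golden ratio, its conjugate and their squares. The alternating term comes from
Cassini's identity and is absorbed in `periodic_part`. -/
theorem golden_part (s : ℂ) (hs : s ^ 2 = 5) (n : ℕ) :
    16 * (((-2 + s) / 20) * ((3 + s) / 2) ^ (n + 2) + ((-2 - s) / 20) * ((3 - s) / 2) ^ (n + 2)
      + ((5 - s) / 20) * ((1 + s) / 2) ^ (n + 2) + ((5 + s) / 20) * ((1 - s) / 2) ^ (n + 2)) =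
    4 * fib n * fib (n + 1) + 8 * fib (n + 1) + 4 / 5 * (-1) ^ n := by
  have hp : ((1 + s) / 2) ^ 2 = (1 + s) / 2 + 1 := by linear_combination hs / 4
  have hq : ((1 - s) / 2) ^ 2 = (1 - s) / 2 + 1 := by linear_combination hs / 4
  have h1 : (3 + s) / 2 = ((1 + s) / 2) ^ 2 := by rw [hp]; ring
  have h2 : (3 - s) / 2 = ((1 - s) / 2) ^ 2 := by rw [hq]; ring
  have e1 := pow_succ_eq_fib hp (n + 1)
  have e2 := pow_succ_eq_fib hq (n + 1)
  have hf : (fib (n + 1 + 1) : ℂ) = fib n + fib (n + 1) := by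
    rw [Nat.fib_add_two]; push_cast; rfl
  rw [hf] at e1 e2
  rw [h1, h2, ← pow_mul, ← pow_mul, mul_comm 2, pow_mul, pow_mul]
  have e1' : ((1 + s) / 2) ^ (n + 2) = _ := e1
  have e2' : ((1 - s) / 2) ^ (n + 2) = _ := e2
  rw [e1', e2', ← fib_cassini]
  generalize (fib n : ℂ) = a
  generalize (fib (n + 1) : ℂ) = b
  have hs2 : s * s = 5 := by rw [← hs]; ring
  ring_nf
  simp only [hs]
  ring

/-- All six bases are sixth roots of unity, so both sides depend only on `n` modulo six. -/
theorem periodic_part (w : ℂ) (hw : w ^ 2 = -3) (n : ℕ) :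
    16 * ((1 / 30) * (-1) ^ n + (-5 / 6) * 1 ^ n
      + (1 / 12 - w / 12) * (1 / 2 + w / 2) ^ n + (1 / 12 + w / 12) * (1 / 2 - w / 2) ^ n
      + (1 / 6 + w / 12) * (-1 / 2 + w / 2) ^ n + (1 / 6 - w / 12) * (-1 / 2 - w / 2) ^ n)
      + 4 / 5 * (-1) ^ n = (squareDefect n : ℂ) := by
  have w3 : w ^ 3 = -3 * w := by linear_combination w * hw
  have w4 : w ^ 4 = 9 := by linear_combination (w ^ 2 - 3) * hw
  have w5 : w ^ 5 = 9 * w := by linear_combination w * w4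
  have w6 : w ^ 6 = -27 := by linear_combination w ^ 2 * w4 + 9 * hw
  have r0 : (-1 : ℂ) ^ 6 = 1 := by norm_num
  have r1 : (1 / 2 + w / 2) ^ 6 = 1 := by ring_nf; simp only [hw, w3, w4, w5, w6]; ring
  have r2 : (1 / 2 - w / 2) ^ 6 = 1 := by ring_nf; simp only [hw, w3, w4, w5, w6]; ring
  have r3 : (-1 / 2 + w / 2) ^ 6 = 1 := by ring_nf; simp only [hw, w3, w4, w5, w6]; ring
  have r4 : (-1 / 2 - w / 2) ^ 6 = 1 := by ring_nf; simp only [hw, w3, w4, w5, w6]; ring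
  have hn : (n : ZMod 6) = ((n % 6 : ℕ) : ZMod 6) := by simp
  have hlt : n % 6 < 6 := Nat.mod_lt _ (by omega)
  have red : ∀ z : ℂ, z ^ 6 = 1 → z ^ n = z ^ (n % 6) := fun z hz => by
    conv_lhs => rw [← Nat.div_add_mod n 6, pow_add, pow_mul, hz, one_pow, one_mul]
  rw [hn, red _ r0, red _ r1, red _ r2, red _ r3, red _ r4]
  generalize n % 6 = r at hlt
  have d0 : squareDefect ((0 : ℕ) : ZMod 6) = -4 := by decide
  have d1 : squareDefect ((1 : ℕ) : ZMod 6) = -16 := by decide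
  have d2 : squareDefect ((2 : ℕ) : ZMod 6) = -8 := by decide
  have d3 : squareDefect ((3 : ℕ) : ZMod 6) = -12 := by decide
  have d4 : squareDefect ((4 : ℕ) : ZMod 6) = -24 := by decide
  have d5 : squareDefect ((5 : ℕ) : ZMod 6) = -16 := by decide
  interval_cases r
  · rw [d0]; push_cast; ring
  · rw [d1]; push_cast; ring
  · rw [d2]; push_cast; ring_nf; simp only [hw]; ring
  · rw [d3]; push_cast; ring_nf; simp only [hw]; ring
  · rw [d4]; push_cast; ring_nf; simp only [hw, w4]; ring
  · rw [d5]; push_cast; ring_nf; simp only [hw, w4]; ring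

end FibAbelian

theorem mainTheorem12 (n : ℕ) (hn : 2 ≤ n) :
    (FibAbelian.h n : ℂ) =
      ((-2 + ((√5 : ℝ) : ℂ)) / 20) * ((3 + ((√5 : ℝ) : ℂ)) / 2) ^ n
      + ((-2 - ((√5 : ℝ) : ℂ)) / 20) * ((3 - ((√5 : ℝ) : ℂ)) / 2) ^ n
      + ((5 - ((√5 : ℝ) : ℂ)) / 20) * ((1 + ((√5 : ℝ) : ℂ)) / 2) ^ n
      + ((5 + ((√5 : ℝ) : ℂ)) / 20) * ((1 - ((√5 : ℝ) : ℂ)) / 2) ^ n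
      + (1 / 30) * (-1) ^ n
      + (-5 / 6) * 1 ^ n
      + (1 / 12 - Complex.I * ((√3 : ℝ) : ℂ) / 12) * (1 / 2 + Complex.I * ((√3 : ℝ) : ℂ) / 2) ^ n
      + (1 / 12 + Complex.I * ((√3 : ℝ) : ℂ) / 12) * (1 / 2 - Complex.I * ((√3 : ℝ) : ℂ) / 2) ^ n
      + (1 / 6 + Complex.I * ((√3 : ℝ) : ℂ) / 12) * (-1 / 2 + Complex.I * ((√3 : ℝ) : ℂ) / 2) ^ n
      + (1 / 6 - Complex.I * ((√3 : ℝ) : ℂ) / 12) * (-1 / 2 - Complex.I * ((√3 : ℝ) : ℂ) / 2) ^ n := by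
  obtain ⟨k, rfl⟩ := Nat.exists_eq_add_of_le' hn
  have hs : ((√5 : ℝ) : ℂ) ^ 2 = 5 := by
    rw [← Complex.ofReal_pow, Real.sq_sqrt (by norm_num)]; norm_num
  have hw : (Complex.I * ((√3 : ℝ) : ℂ)) ^ 2 = -3 := by
    rw [mul_pow, Complex.I_sq, ← Complex.ofReal_pow, Real.sq_sqrt (by norm_num)]; norm_num
  have h1 := FibAbelian.golden_part _ hs k
  have h2 := FibAbelian.periodic_part _ hw (k + 2)
  have h3 : (16 * (FibAbelian.h (k + 2) : ℂ)) = 4 * Nat.fib k * Nat.fib (k + 1)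
      + 8 * Nat.fib (k + 1) + (FibAbelian.squareDefect ((k + 2 : ℕ) : ZMod 6) : ℂ) := by
    have := FibAbelian.sixteen_mul_h k
    rw [show ((k + 2 : ℕ) : ZMod 6) = k + 2 by push_cast; rfl]
    exact_mod_cast this
  have h4 : (-1 : ℂ) ^ (k + 2) = (-1) ^ k := by rw [pow_add]; norm_num
  rw [h4] at h2 ⊢
  linear_combination (h3 - h1 - h2) / 16
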